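/- Write points of $\mathbb C^2$ as $(z,w)$ and let $H_f=\begin{pmatrix} f_{z\bar z}&f_{z\bar w}\\ f_{\bar z w}&f_{w\bar w}\end{pmatrix}$ be the complex Hessian of a real function $f$, $\mathscr H_f=\det H_f$, and $H_f(V,V)=f_{z\bar z}|V_1|^2+f_{w\bar w}|V_2|^2+2\,\mathrm{Re}(f_{z\bar w}V_1\bar V_2)$. Call $f$ plurisubharmonic at a point if $H_f$ is positive semi-definite there. Let $\Omega=\{r<0\}\subset\mathbb C^2$, where $r:\mathbb C^2\to\mathbb R$ is smooth and $\nabla r\ne0$ on $b\Omega$. Put $L_r=r_w\,\partial_z-r_z\,\partial_w$, i.e. the vector $(r_w,-r_z)$, $N_r=(r_{\bar z},r_{\bar w})$ (the outward real normal direction), and $\mathscr L_r=H_r(L_r,L_r)$ (the Levi form). Let $W=\{p\in b\Omega:\mathscr L_r(p)=0\}$ be the set of weakly pseudoconvex boundary points and let $p_0\in W$. Assume that $\Omega$ is pseudoconvex near $p_0$, i.e. $\mathscr L_r\ge0$ on $b\Omega$ near $p_0$. (This holds in particular if $r$ is plurisubharmonic on $b\Omega$ near $p_0$.) Let $X$ be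 a real-valued function, smooth near $p_0$, with $X(p_0)=0$, and let $P=1+X$. Suppose that 1. $L_r(P)(p)=r_wP_z-r_zP_w=0$ for all $p\in W$ in a neighborhood of $p_0$, and 2. $H_P(L_r,L_r)(p_0)\neq0$. Let $I_L$ be the interior of the set of all $L\in\mathbb R$ for which there is $K_0$ such that for every $K\ge K_0$ the function $r(1+Kr+LX)$ is plurisubharmonic at the points in the normal direction from $W$ near $p_0$; that is, there is a neighborhood $U$ of $p_0$ (which may depend on $K$ and $L$) such that $r(1+Kr+LX)$ is plurisubharmonic at each point $p-sN_r(p)\in U$ with $p\in W\cap U$ and $s\ge0$. (a) If $r$ is plurisubharmonic on $b\Omega$ near $p_0$, then $I_L=(-\infty,L_0)$ for some $L_0\in\mathbb R$ when $H_P(L_r,L_r)(p_0)>0$, and $I_L=(L_0,\infty)$ for some $L_0\in\mathbb R$ when $H_P(L_r,L_r)(p_0)<0$. (b) Let $L\in I_L$ be such that, for some constant $C$, $$-\mathscr H_{r(1+LX)}\le C\,\mathscr L_r\qquad\text{on } b\Omega \text{ near } p_0 .$$ Then there is $K>0$ such that $\rho=r(1+Kr+LX)$ is plurisubharmonic at every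 point of $U\cap\overline\Omega$ for some neighborhood $U$ of $p_0$. In particular, if some $L\in I_L$ satisfies the inequality in (b), then there are $K>0$ and $L\in I_L$ for which $\rho=r(1+Kr+LX)$ is plurisubharmonic on $\overline\Omega$ near $p_0$. -/

import Mathlib

open Filter Topology
open scoped ContDiff ComplexConjugate ComplexOrder

/-! Points of `ℂ²` are pairs `(z, w) : ℂ × ℂ`.  Only the topology of `ℂ²` and real derivatives
are used below, so the choice of norm on the product plays no role. -/

namespace PshDefining

noncomputable section

/-- `∂F/∂ζ = (∂F/∂x - i ∂F/∂y) / 2`, where `ζ = x + i y` is the complex coordinate along the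
(complex) direction `v`. -/
def wirtinger (v : ℂ × ℂ) (F : ℂ × ℂ → ℂ) (p : ℂ × ℂ) : ℂ :=
  (fderiv ℝ F p v - Complex.I * fderiv ℝ F p (Complex.I • v)) / 2

/-- `∂F/∂ζ̄ = (∂F/∂x + i ∂F/∂y) / 2`. -/
def wirtingerBar (v : ℂ × ℂ) (F : ℂ × ℂ → ℂ) (p : ℂ × ℂ) : ℂ :=
  (fderiv ℝ F p v + Complex.I * fderiv ℝ F p (Complex.I • v)) / 2

/-- `F_z`. -/
def dz (F : ℂ × ℂ → ℂ) : ℂ × ℂ → ℂ := wirtinger (1, 0) F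

/-- `F_w`. -/
def dw (F : ℂ × ℂ → ℂ) : ℂ × ℂ → ℂ := wirtinger (0, 1) F

/-- `F_z̄`. -/
def dzBar (F : ℂ × ℂ → ℂ) : ℂ × ℂ → ℂ := wirtingerBar (1, 0) F

/-- `F_w̄`. -/
def dwBar (F : ℂ × ℂ → ℂ) : ℂ × ℂ → ℂ := wirtingerBar (0, 1) F

/-- A real-valued function, seen as a complex-valued one. -/
def toC (f : ℂ × ℂ → ℝ) : ℂ × ℂ → ℂ := fun p => (f p : ℂ)

/-- The complex Hessian `H_f` of a real-valued function `f` at `p`, with rows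
`(f_{z z̄}, f_{z w̄})` and `(f_{z̄ w}, f_{w w̄})`. -/
def complexHessian (f : ℂ × ℂ → ℝ) (p : ℂ × ℂ) : Matrix (Fin 2) (Fin 2) ℂ :=
  !![dzBar (dz (toC f)) p, dwBar (dz (toC f)) p;
     dzBar (dw (toC f)) p, dwBar (dw (toC f)) p]

/-- `H_f(V, W) = f_{z z̄} V₁ W̄₁ + f_{w w̄} V₂ W̄₂ + f_{z w̄} V₁ W̄₂ + f_{z̄ w} V₂ W̄₁` at `p`. -/
def hessianForm (f : ℂ × ℂ → ℝ) (p V W : ℂ × ℂ) : ℂ :=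
  complexHessian f p 0 0 * V.1 * conj W.1 + complexHessian f p 1 1 * V.2 * conj W.2
    + complexHessian f p 0 1 * V.1 * conj W.2 + complexHessian f p 1 0 * V.2 * conj W.1

/-- The determinant of the complex Hessian; it is real where `f` is `C²`, and `re` only changes
its type. -/
def hessianDet (f : ℂ × ℂ → ℝ) (p : ℂ × ℂ) : ℝ := (complexHessian f p).det.re

/-- The complex tangential vector `L_r = r_w ∂/∂z - r_z ∂/∂w` at `p`, by its components. -/
def tangentVec (r : ℂ × ℂ → ℝ) (p : ℂ × ℂ) : ℂ × ℂ := (dw (toC r) p, -dz (toC r) p)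

/-- The derivative `L_r(f) = r_w f_z - r_z f_w` at `p`. -/
def tangentDeriv (r f : ℂ × ℂ → ℝ) (p : ℂ × ℂ) : ℂ :=
  dw (toC r) p * dz (toC f) p - dz (toC r) p * dw (toC f) p

/-- The vector `N_r = r_z̄ ∂/∂z + r_w̄ ∂/∂w` at `p`, by its components.  As a vector of `ℝ⁴ = ℂ²`
it is half of the Euclidean gradient of `r`, so it spans the real normal of the boundary and
points outward. -/
def normalVec (r : ℂ × ℂ → ℝ) (p : ℂ × ℂ) : ℂ × ℂ := (dzBar (toC r) p, dwBar (toC r) p)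

/-- `H_f(L_r, L_r)(p)`; it is real where `f` is `C²`, and `re` only changes its type. -/
def hessianTangent (f r : ℂ × ℂ → ℝ) (p : ℂ × ℂ) : ℝ :=
  (hessianForm f p (tangentVec r p) (tangentVec r p)).re

/-- The Levi form `H_r(L_r, L_r)(p)`. -/
def leviForm (r : ℂ × ℂ → ℝ) (p : ℂ × ℂ) : ℝ := hessianTangent r r p

/-- `r` is a smooth defining function of `Ω`. -/
structure IsDefiningFunction (r : ℂ × ℂ → ℝ) (Ω : Set (ℂ × ℂ)) : Prop where
  smooth : ContDiff ℝ ∞ r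
  eq_sublevel : Ω = {p | r p < 0}
  fderiv_ne_zero : ∀ p ∈ frontier Ω, fderiv ℝ r p ≠ 0

/-- `f` is plurisubharmonic at the point `p`: its complex Hessian is positive semi-definite. -/
def PshAt (f : ℂ × ℂ → ℝ) (p : ℂ × ℂ) : Prop := (complexHessian f p).PosSemidef

/-- The boundary of `Ω` is pseudoconvex near `p₀`.  (In `ℂ²` the complex tangent space at a
boundary point is spanned by `L_r`.) -/
def PseudoconvexNear (r : ℂ × ℂ → ℝ) (Ω : Set (ℂ × ℂ)) (p₀ : ℂ × ℂ) : Prop :=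
  ∀ᶠ p in 𝓝 p₀, p ∈ frontier Ω → 0 ≤ leviForm r p

/-- `r` is plurisubharmonic on the boundary of `Ω` near `p₀`. -/
def PshOnBoundaryNear (r : ℂ × ℂ → ℝ) (Ω : Set (ℂ × ℂ)) (p₀ : ℂ × ℂ) : Prop :=
  ∀ᶠ p in 𝓝 p₀, p ∈ frontier Ω → PshAt r p

/-- The set `W` of weakly pseudoconvex boundary points. -/
def weakPoints (r : ℂ × ℂ → ℝ) (Ω : Set (ℂ × ℂ)) : Set (ℂ × ℂ) :=
  {p | p ∈ frontier Ω ∧ leviForm r p = 0}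

/-- `ρ = r (1 + K r + L X)`. -/
def modified (r X : ℂ × ℂ → ℝ) (K L : ℝ) : ℂ × ℂ → ℝ :=
  fun q => r q * (1 + K * r q + L * X q)

/-- Near `p₀`, the function `f` is plurisubharmonic at the points that lie on the inward real
normals issuing from weakly pseudoconvex points. -/
def PshOnWeakNormalsNear (f r : ℂ × ℂ → ℝ) (Ω : Set (ℂ × ℂ)) (p₀ : ℂ × ℂ) : Prop :=
  ∃ U ∈ 𝓝 p₀, ∀ p ∈ U ∩ weakPoints r Ω, ∀ s : ℝ, 0 ≤ s →
    p - s • normalVec r p ∈ U → PshAt f (p - s • normalVec r p)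

/-- The open interval `I_L`: the interior of the set of all `L` such that, for all large `K`,
the function `r (1 + K r + L X)` is plurisubharmonic near `p₀` at the points in the normal
direction from weakly pseudoconvex points. -/
def admissibleInterval (r X : ℂ × ℂ → ℝ) (Ω : Set (ℂ × ℂ)) (p₀ : ℂ × ℂ) : Set ℝ :=
  interior {L | ∃ K₀ : ℝ, ∀ K ≥ K₀, PshOnWeakNormalsNear (modified r X K L) r Ω p₀}

end

end PshDefining

namespace PshDefining

/-! Put ρ = r(1+Kr+LX) and test its Hessian in the frame L_r, N_r: a = H_ρ(L_r,L_r), b =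
H_ρ(L_r,N_r), c = H_ρ(N_r,N_r). Plurisubharmonicity follows from c > 0 and |b|² ≤ ac. Since L_r
annihilates r, on the boundary a = (1+LX)·Levi, b is independent of K, and K enters c only through
2K|∂r|⁴. At p₀ the derivative of a along N_r is an affine function of L (`normalSlope`), also
independent of K, with leading coefficient H_P(L_r,L_r)·N_r(r) ≠ 0.

Core estimate (`exists_eventually_pshAt`): let the slope be negative and |b|² ≤ C·Levi on a set E of
boundary points. Moving inward by s from p ∈ E, a ≥ Levi(p)/2 + (A/2)s with A = -slope, and |b|² ≤
2|C|·Levi(p) + (A/2)s near p₀. Choosing K so that c exceeds 4|C|+1 gives |b|² ≤ ac.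

For (a), E = W: where r is plurisubharmonic, Levi = 0 forces H_r(L_r,N_r) = 0, and with L_r(P) = 0
this gives b = 0. Conversely, plurisubharmonicity along the normal at p₀ forces slope ≤ 0. Hence I_L
= {slope < 0}, a half-line. For (b), E = bΩ: the determinant inequality is converted into |b|² ≤
C'·Levi by the Gram identity, and all of Ω̄ near p₀ is swept out by lines in the fixed direction
N_r(p₀). -/

/-! ### Wirtinger calculus and the Hessian of r(1+Kr+LX) -/

theorem contDiffAt_toC {f : ℂ × ℂ → ℝ} {n : WithTop ℕ∞} {p : ℂ × ℂ} (hf : ContDiffAt ℝ n f p) :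
    ContDiffAt ℝ n (toC f) p :=
  Complex.ofRealCLM.contDiff.contDiffAt.comp p hf

theorem fderiv_toC {f : ℂ × ℂ → ℝ} {p : ℂ × ℂ} (hf : DifferentiableAt ℝ f p) (v : ℂ × ℂ) :
    fderiv ℝ (toC f) p v = (fderiv ℝ f p v : ℂ) := by
  have := (Complex.ofRealCLM.hasFDerivAt.comp p hf.hasFDerivAt).fderiv
  change fderiv ℝ (Complex.ofRealCLM ∘ f) p v = _
  rw [this]; rfl

theorem contDiffAt_wirtinger {F : ℂ × ℂ → ℂ} {m n : WithTop ℕ∞} {p : ℂ × ℂ}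
    (hF : ContDiffAt ℝ n F p) (hmn : m + 1 ≤ n) (v : ℂ × ℂ) :
    ContDiffAt ℝ m (wirtinger v F) p := by
  have h := hF.fderiv_right hmn
  have h1 : ∀ u, ContDiffAt ℝ m (fun q => fderiv ℝ F q u) p := fun u =>
    h.clm_apply contDiffAt_const
  exact ((h1 v).sub (contDiffAt_const.mul (h1 _))).div_const 2

theorem contDiffAt_wirtingerBar {F : ℂ × ℂ → ℂ} {m n : WithTop ℕ∞} {p : ℂ × ℂ}
    (hF : ContDiffAt ℝ n F p) (hmn : m + 1 ≤ n) (v : ℂ × ℂ) :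
    ContDiffAt ℝ m (wirtingerBar v F) p := by
  have h := hF.fderiv_right hmn
  have h1 : ∀ u, ContDiffAt ℝ m (fun q => fderiv ℝ F q u) p := fun u =>
    h.clm_apply contDiffAt_const
  exact ((h1 v).add (contDiffAt_const.mul (h1 _))).div_const 2

theorem wirtingerBar_toC {f : ℂ × ℂ → ℝ} {p : ℂ × ℂ} (hf : DifferentiableAt ℝ f p)
    (v : ℂ × ℂ) : wirtingerBar v (toC f) p = conj (wirtinger v (toC f) p) := by
  simp [wirtinger, wirtingerBar, fderiv_toC hf, map_ofNat]

theorem wirtinger_mul {F G : ℂ × ℂ → ℂ} {p : ℂ × ℂ} (hF : DifferentiableAt ℝ F p)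
    (hG : DifferentiableAt ℝ G p) (v : ℂ × ℂ) :
    wirtinger v (fun q => F q * G q) p = F p * wirtinger v G p + wirtinger v F p * G p := by
  simp only [wirtinger, fderiv_fun_mul hF hG, add_apply,
    smul_apply, smul_eq_mul]
  ring

theorem wirtingerBar_mul {F G : ℂ × ℂ → ℂ} {p : ℂ × ℂ} (hF : DifferentiableAt ℝ F p)
    (hG : DifferentiableAt ℝ G p) (v : ℂ × ℂ) :
    wirtingerBar v (fun q => F q * G q) p
      = F p * wirtingerBar v G p + wirtingerBar v F p * G p := by
  simp only [wirtingerBar, fderiv_fun_mul hF hG, add_apply,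
    smul_apply, smul_eq_mul]
  ring

theorem wirtingerBar_add {F G : ℂ × ℂ → ℂ} {p : ℂ × ℂ} (hF : DifferentiableAt ℝ F p)
    (hG : DifferentiableAt ℝ G p) (v : ℂ × ℂ) :
    wirtingerBar v (fun q => F q + G q) p = wirtingerBar v F p + wirtingerBar v G p := by
  simp only [wirtingerBar, fderiv_fun_add hF hG, add_apply]
  ring

theorem wirtinger_add {F G : ℂ × ℂ → ℂ} {p : ℂ × ℂ} (hF : DifferentiableAt ℝ F p)
    (hG : DifferentiableAt ℝ G p) (v : ℂ × ℂ) :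
    wirtinger v (fun q => F q + G q) p = wirtinger v F p + wirtinger v G p := by
  simp only [wirtinger, fderiv_fun_add hF hG, add_apply]
  ring

theorem wirtinger_const (c : ℂ) (p v : ℂ × ℂ) : wirtinger v (fun _ => c) p = 0 := by
  simp [wirtinger]

theorem wirtingerBar_const (c : ℂ) (p v : ℂ × ℂ) : wirtingerBar v (fun _ => c) p = 0 := by
  simp [wirtingerBar]

theorem wirtingerBar_congr {F G : ℂ × ℂ → ℂ} {p : ℂ × ℂ} (h : F =ᶠ[𝓝 p] G) (v : ℂ × ℂ) :
    wirtingerBar v F p = wirtingerBar v G p := by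
  simp only [wirtingerBar, h.fderiv_eq]

theorem eventually_differentiableAt {F : ℂ × ℂ → ℂ} {p : ℂ × ℂ} (hF : ContDiffAt ℝ 2 F p) :
    ∀ᶠ q in 𝓝 p, DifferentiableAt ℝ F q :=
  (hF.eventually (by simp)).mono fun _ h => h.differentiableAt (by simp)

theorem differentiableAt_wirtinger {F : ℂ × ℂ → ℂ} {p : ℂ × ℂ} (hF : ContDiffAt ℝ 2 F p)
    (v : ℂ × ℂ) : DifferentiableAt ℝ (wirtinger v F) p :=
  (contDiffAt_wirtinger (m := 1) hF (by norm_num) v).differentiableAt (by simp)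

theorem wirtingerBar_wirtinger_mul {F G : ℂ × ℂ → ℂ} {p : ℂ × ℂ} (hF : ContDiffAt ℝ 2 F p)
    (hG : ContDiffAt ℝ 2 G p) (u v : ℂ × ℂ) :
    wirtingerBar u (wirtinger v (fun q => F q * G q)) p
      = F p * wirtingerBar u (wirtinger v G) p + wirtingerBar u F p * wirtinger v G p
        + wirtinger v F p * wirtingerBar u G p + wirtingerBar u (wirtinger v F) p * G p := by
  have hF1 := hF.differentiableAt (by simp)
  have hG1 := hG.differentiableAt (by simp)
  have hF2 := differentiableAt_wirtinger hF v
  have hG2 := differentiableAt_wirtinger hG v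
  have h : wirtinger v (fun q => F q * G q) =ᶠ[𝓝 p]
      fun q => F q * wirtinger v G q + wirtinger v F q * G q := by
    filter_upwards [eventually_differentiableAt hF, eventually_differentiableAt hG] with q h1 h2
    exact wirtinger_mul h1 h2 v
  rw [wirtingerBar_congr h, wirtingerBar_add (hF1.fun_mul hG2) (hF2.fun_mul hG1),
    wirtingerBar_mul hF1 hG2, wirtingerBar_mul hF2 hG1]
  ring

theorem wirtingerBar_wirtinger_add {F G : ℂ × ℂ → ℂ} {p : ℂ × ℂ} (hF : ContDiffAt ℝ 2 F p)
    (hG : ContDiffAt ℝ 2 G p) (u v : ℂ × ℂ) :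
    wirtingerBar u (wirtinger v (fun q => F q + G q)) p
      = wirtingerBar u (wirtinger v F) p + wirtingerBar u (wirtinger v G) p := by
  have h : wirtinger v (fun q => F q + G q) =ᶠ[𝓝 p]
      fun q => wirtinger v F q + wirtinger v G q := by
    filter_upwards [eventually_differentiableAt hF, eventually_differentiableAt hG] with q h1 h2
    exact wirtinger_add h1 h2 v
  rw [wirtingerBar_congr h, wirtingerBar_add (differentiableAt_wirtinger hF v)
    (differentiableAt_wirtinger hG v)]

theorem wirtingerBar_wirtinger_const (c : ℂ) (p u v : ℂ × ℂ) :
    wirtingerBar u (wirtinger v (fun _ => c)) p = 0 := by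
  have : wirtinger v (fun _ => c) = fun _ => 0 := funext fun q => wirtinger_const c q v
  rw [this, wirtingerBar_const]

/-- Second order derivatives of `r (1 + K r + L X)`. -/
theorem wirtingerBar_wirtinger_modified {R X : ℂ × ℂ → ℂ} {p : ℂ × ℂ} (hR : ContDiffAt ℝ 2 R p)
    (hX : ContDiffAt ℝ 2 X p) (K L : ℂ) (u v : ℂ × ℂ) :
    wirtingerBar u (wirtinger v (fun q => R q * (1 + K * R q + L * X q))) p
      = (1 + 2 * K * R p + L * X p) * wirtingerBar u (wirtinger v R) p
        + L * R p * wirtingerBar u (wirtinger v X) p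
        + L * (wirtinger v R p * wirtingerBar u X p + wirtinger v X p * wirtingerBar u R p)
        + 2 * K * (wirtinger v R p * wirtingerBar u R p) := by
  have hc : ∀ c : ℂ, ContDiffAt ℝ 2 (fun _ : ℂ × ℂ => c) p := fun c => contDiffAt_const
  have hd : ∀ c : ℂ, DifferentiableAt ℝ (fun _ : ℂ × ℂ => c) p := fun c =>
    differentiableAt_const c
  have hKR := (hc K).mul hR
  have hLX := (hc L).mul hX
  have hR1 := hR.differentiableAt (by simp)
  have hX1 := hX.differentiableAt (by simp)
  have hKR1 := (hd K).fun_mul hR1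
  have hLX1 := (hd L).fun_mul hX1
  rw [wirtingerBar_wirtinger_mul hR (((hc 1).add hKR).add hLX),
    wirtingerBar_wirtinger_add ((hc 1).add hKR) hLX, wirtingerBar_wirtinger_add (hc 1) hKR,
    wirtingerBar_wirtinger_mul (hc K) hR, wirtingerBar_wirtinger_mul (hc L) hX,
    wirtinger_add ((hd 1).fun_add hKR1) hLX1, wirtinger_add (hd 1) hKR1,
    wirtinger_mul (hd K) hR1, wirtinger_mul (hd L) hX1,
    wirtingerBar_add ((hd 1).fun_add hKR1) hLX1, wirtingerBar_add (hd 1) hKR1,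
    wirtingerBar_mul (hd K) hR1, wirtingerBar_mul (hd L) hX1]
  simp only [wirtinger_const, wirtingerBar_const, wirtingerBar_wirtinger_const]
  ring

theorem toC_modified (r X : ℂ × ℂ → ℝ) (K L : ℝ) :
    toC (modified r X K L)
      = fun q => toC r q * (1 + (K : ℂ) * toC r q + (L : ℂ) * toC X q) := by
  funext q; simp [toC, modified]

theorem hessianForm_modified {r X : ℂ × ℂ → ℝ} {p : ℂ × ℂ} (hr : ContDiffAt ℝ 2 r p)
    (hX : ContDiffAt ℝ 2 X p) (K L : ℝ) (V W : ℂ × ℂ) :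
    hessianForm (modified r X K L) p V W
      = (1 + 2 * K * r p + L * X p) * hessianForm r p V W + L * r p * hessianForm X p V W
        + L * ((dz (toC r) p * V.1 + dw (toC r) p * V.2)
              * conj (dz (toC X) p * W.1 + dw (toC X) p * W.2)
            + (dz (toC X) p * V.1 + dw (toC X) p * V.2)
              * conj (dz (toC r) p * W.1 + dw (toC r) p * W.2))
        + 2 * K * ((dz (toC r) p * V.1 + dw (toC r) p * V.2)
              * conj (dz (toC r) p * W.1 + dw (toC r) p * W.2)) := by
  have hR := contDiffAt_toC hr
  have hXC := contDiffAt_toC hX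
  have h1 := hr.differentiableAt (by simp)
  have h2 := hX.differentiableAt (by simp)
  simp only [hessianForm, complexHessian, dz, dw, dzBar, dwBar, toC_modified,
    wirtingerBar_wirtinger_modified hR hXC, wirtingerBar_toC h1, wirtingerBar_toC h2,
    Matrix.of_apply, Matrix.cons_val', Matrix.cons_val_zero, Matrix.cons_val_one,
    Matrix.cons_val_fin_one, map_add, map_mul]
  simp only [toC]
  ring

/-! ### Hermitian symmetry, Gram determinant and positivity tests -/

/-- Written through the real second derivative so that its symmetry yields Hermitian symmetry of the
complex Hessian. -/
theorem wirtingerBar_wirtinger_toC {f : ℂ × ℂ → ℝ} {p : ℂ × ℂ} (hf : ContDiffAt ℝ 2 f p)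
    (u v : ℂ × ℂ) :
    wirtingerBar u (wirtinger v (toC f)) p
      = ((fderiv ℝ (fderiv ℝ f) p u v + fderiv ℝ (fderiv ℝ f) p (Complex.I • u) (Complex.I • v)
          : ℝ)
        + Complex.I * (fderiv ℝ (fderiv ℝ f) p (Complex.I • u) v
          - fderiv ℝ (fderiv ℝ f) p u (Complex.I • v) : ℝ)) / 4 := by
  have hd : DifferentiableAt ℝ (fderiv ℝ f) p :=
    (hf.fderiv_right (m := 1) (by norm_num)).differentiableAt (by simp)
  have hda : ∀ v, DifferentiableAt ℝ (fun q => fderiv ℝ f q v) p := fun v =>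
    hd.clm_apply (differentiableAt_const v)
  have hfd : ∀ u v, fderiv ℝ (fun q => fderiv ℝ f q v) p u = fderiv ℝ (fderiv ℝ f) p u v := by
    intro u v
    rw [fderiv_clm_apply hd (differentiableAt_const v)]
    simp
  have hC : ∀ v, DifferentiableAt ℝ (toC fun q => fderiv ℝ f q v) p := fun v =>
    Complex.ofRealCLM.differentiableAt.comp p (hda v)
  have h : wirtinger v (toC f) =ᶠ[𝓝 p] fun q =>
      (1 / 2 : ℂ) * toC (fun q => fderiv ℝ f q v) q
        + (-Complex.I / 2) * toC (fun q => fderiv ℝ f q (Complex.I • v)) q := by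
    filter_upwards [hf.eventually (by simp)] with q hq
    simp only [wirtinger, fderiv_toC (hq.differentiableAt (by simp)), toC]
    ring
  have hc : ∀ c : ℂ, DifferentiableAt ℝ (fun _ : ℂ × ℂ => c) p := differentiableAt_const
  rw [wirtingerBar_congr h, wirtingerBar_add ((hc _).fun_mul (hC _)) ((hc _).fun_mul (hC _)),
    wirtingerBar_mul (hc _) (hC _), wirtingerBar_mul (hc _) (hC _), wirtingerBar_const,
    wirtingerBar_const]
  simp only [wirtingerBar, fderiv_toC (hda _), hfd]
  push_cast
  linear_combination (-(1 / 4 : ℂ) * (fderiv ℝ (fderiv ℝ f) p (Complex.I • u) (Complex.I • v)))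
    * Complex.I_sq

theorem conj_wirtingerBar_wirtinger_toC {f : ℂ × ℂ → ℝ} {p : ℂ × ℂ} (hf : ContDiffAt ℝ 2 f p)
    (u v : ℂ × ℂ) :
    conj (wirtingerBar u (wirtinger v (toC f)) p) = wirtingerBar v (wirtinger u (toC f)) p := by
  have hs : IsSymmSndFDerivAt ℝ f p := hf.isSymmSndFDerivAt (by simp)
  rw [wirtingerBar_wirtinger_toC hf, wirtingerBar_wirtinger_toC hf,
    hs.eq v u, hs.eq (Complex.I • v) (Complex.I • u), hs.eq (Complex.I • v) u,
    hs.eq v (Complex.I • u)]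
  simp only [map_div₀, map_add, map_mul, map_ofNat, Complex.conj_ofReal, Complex.conj_I]
  simp
  ring

theorem isHermitian_complexHessian {f : ℂ × ℂ → ℝ} {p : ℂ × ℂ} (hf : ContDiffAt ℝ 2 f p) :
    (complexHessian f p).IsHermitian := by
  ext i j
  fin_cases i <;> fin_cases j <;>
    simp [complexHessian, dz, dw, dzBar, dwBar, conj_wirtingerBar_wirtinger_toC hf]

theorem conj_hessianForm {f : ℂ × ℂ → ℝ} {p : ℂ × ℂ} (hf : ContDiffAt ℝ 2 f p) (V W : ℂ × ℂ) :
    conj (hessianForm f p V W) = hessianForm f p W V := by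
  have h : ∀ i j, conj (complexHessian f p i j) = complexHessian f p j i := fun i j =>
    (isHermitian_complexHessian hf).apply j i
  simp only [hessianForm, map_add, map_mul, h, Complex.conj_conj]
  ring

theorem hessianForm_self_eq {f : ℂ × ℂ → ℝ} {p : ℂ × ℂ} (hf : ContDiffAt ℝ 2 f p) (V : ℂ × ℂ) :
    hessianForm f p V V = ((hessianForm f p V V).re : ℂ) :=
  (Complex.conj_eq_iff_re.1 (conj_hessianForm hf V V)).symm

/-- The Gram determinant of the complex Hessian on a pair of vectors. -/
theorem hessianDet_mul_normSq {f : ℂ × ℂ → ℝ} {p : ℂ × ℂ} (hf : ContDiffAt ℝ 2 f p)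
    (V W : ℂ × ℂ) :
    hessianDet f p * Complex.normSq (V.1 * W.2 - V.2 * W.1)
      = (hessianForm f p V V).re * (hessianForm f p W W).re
        - Complex.normSq (hessianForm f p V W) := by
  have h1 : (complexHessian f p).det * (Complex.normSq (V.1 * W.2 - V.2 * W.1) : ℂ)
      = hessianForm f p V V * hessianForm f p W W - (Complex.normSq (hessianForm f p V W) : ℂ) := by
    rw [Complex.normSq_eq_conj_mul_self, Complex.normSq_eq_conj_mul_self, conj_hessianForm hf,
      Matrix.det_fin_two]
    simp only [hessianForm, map_sub, map_mul]
    ring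
  rw [hessianForm_self_eq hf V, hessianForm_self_eq hf W] at h1
  have h2 := congrArg Complex.re h1
  simpa [hessianDet] using h2

theorem hessianForm_eq_dotProduct (f : ℂ × ℂ → ℝ) (p : ℂ × ℂ) (x : Fin 2 → ℂ) :
    star x ⬝ᵥ (complexHessian f p).mulVec x
      = hessianForm f p (conj (x 0), conj (x 1)) (conj (x 0), conj (x 1)) := by
  simp [dotProduct, Matrix.mulVec, Fin.sum_univ_two, hessianForm]
  ring

theorem pshAt_iff {f : ℂ × ℂ → ℝ} {p : ℂ × ℂ} (hf : ContDiffAt ℝ 2 f p) :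
    PshAt f p ↔ ∀ V, 0 ≤ (hessianForm f p V V).re := by
  rw [PshAt, Matrix.posSemidef_iff_dotProduct_mulVec]
  constructor
  · rintro ⟨-, h⟩ V
    have := h ![conj V.1, conj V.2]
    rw [hessianForm_eq_dotProduct] at this
    simpa using (Complex.le_def.1 this).1
  · refine fun h => ⟨isHermitian_complexHessian hf, fun x => ?_⟩
    rw [hessianForm_eq_dotProduct, hessianForm_self_eq hf]
    exact_mod_cast h _

/-- Sylvester's criterion in the basis V, W: the Gram identity for (V, W) gives det ≥ 0, and the one
for (Z, W) then gives positivity at any Z. -/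
theorem pshAt_of_pos_of_le {f : ℂ × ℂ → ℝ} {p V W : ℂ × ℂ} (hf : ContDiffAt ℝ 2 f p)
    (hVW : V.1 * W.2 - V.2 * W.1 ≠ 0) (hW : 0 < (hessianForm f p W W).re)
    (h : Complex.normSq (hessianForm f p V W)
      ≤ (hessianForm f p V V).re * (hessianForm f p W W).re) : PshAt f p := by
  have hdet : 0 ≤ hessianDet f p := by
    refine nonneg_of_mul_nonneg_left ?_ (Complex.normSq_pos.2 hVW)
    rw [hessianDet_mul_normSq hf]
    linarith
  refine (pshAt_iff hf).2 fun Z => nonneg_of_mul_nonneg_left ?_ hW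
  have := hessianDet_mul_normSq hf Z W
  have h1 := mul_nonneg hdet (Complex.normSq_nonneg (Z.1 * W.2 - Z.2 * W.1))
  have h2 := Complex.normSq_nonneg (hessianForm f p Z W)
  linarith

/-- Cauchy–Schwarz: a null vector of a semi-definite form lies in its kernel. -/
theorem hessianForm_eq_zero_of_pshAt {f : ℂ × ℂ → ℝ} {p V : ℂ × ℂ} (hf : ContDiffAt ℝ 2 f p)
    (h : PshAt f p) (hV : (hessianForm f p V V).re = 0) (W : ℂ × ℂ) :
    hessianForm f p V W = 0 := by
  have h1 := hessianDet_mul_normSq hf V W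
  have h2 : 0 ≤ hessianDet f p := (Complex.le_def.1 (Matrix.PosSemidef.det_nonneg h)).1
  have h3 := mul_nonneg h2 (Complex.normSq_nonneg (V.1 * W.2 - V.2 * W.1))
  rw [h1, hV] at h3
  exact Complex.normSq_eq_zero.1 (le_antisymm (by linarith) (Complex.normSq_nonneg _))

/-- The squared length `|f_z|² + |f_w|²` of the complex gradient. -/
noncomputable def gradSq (f : ℂ × ℂ → ℝ) (p : ℂ × ℂ) : ℝ :=
  Complex.normSq (dz (toC f) p) + Complex.normSq (dw (toC f) p)

theorem fderiv_apply_eq {f : ℂ × ℂ → ℝ} {p : ℂ × ℂ} (hf : DifferentiableAt ℝ f p) (V : ℂ × ℂ) :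
    fderiv ℝ f p V = 2 * (dz (toC f) p * V.1 + dw (toC f) p * V.2).re := by
  have hV : V = V.1.re • ((1, 0) : ℂ × ℂ) + V.1.im • (Complex.I • ((1, 0) : ℂ × ℂ))
      + (V.2.re • ((0, 1) : ℂ × ℂ) + V.2.im • (Complex.I • ((0, 1) : ℂ × ℂ))) := by
    ext <;> simp
  conv_lhs => rw [hV]
  simp only [map_add, map_smul, smul_eq_mul, dz, dw, wirtinger, fderiv_toC hf]
  simp
  ring

theorem normalVec_eq {r : ℂ × ℂ → ℝ} {p : ℂ × ℂ} (hr : DifferentiableAt ℝ r p) :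
    normalVec r p = (conj (dz (toC r) p), conj (dw (toC r) p)) := by
  simp only [normalVec, dzBar, dwBar, dz, dw, wirtingerBar_toC hr]

theorem deriv_normalVec {r : ℂ × ℂ → ℝ} {p : ℂ × ℂ} (hr : DifferentiableAt ℝ r p) :
    dz (toC r) p * (normalVec r p).1 + dw (toC r) p * (normalVec r p).2 = gradSq r p := by
  rw [normalVec_eq hr, gradSq, Complex.ofReal_add, ← Complex.mul_conj, ← Complex.mul_conj]

theorem wedge_tangentVec_normalVec {r : ℂ × ℂ → ℝ} {p : ℂ × ℂ} (hr : DifferentiableAt ℝ r p) :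
    (tangentVec r p).1 * (normalVec r p).2 - (tangentVec r p).2 * (normalVec r p).1
      = gradSq r p := by
  rw [← deriv_normalVec hr, tangentVec]
  ring

theorem fderiv_normalVec {r : ℂ × ℂ → ℝ} {p : ℂ × ℂ} (hr : DifferentiableAt ℝ r p) :
    fderiv ℝ r p (normalVec r p) = 2 * gradSq r p := by
  rw [fderiv_apply_eq hr, deriv_normalVec hr, Complex.ofReal_re]

theorem gradSq_pos {r : ℂ × ℂ → ℝ} {p : ℂ × ℂ} (hr : DifferentiableAt ℝ r p)
    (h : fderiv ℝ r p ≠ 0) : 0 < gradSq r p := by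
  by_contra h0
  have h1 := Complex.normSq_nonneg (dz (toC r) p)
  have h2 := Complex.normSq_nonneg (dw (toC r) p)
  rw [gradSq] at h0
  have h3 : dz (toC r) p = 0 := Complex.normSq_eq_zero.1 (by linarith)
  have h4 : dw (toC r) p = 0 := Complex.normSq_eq_zero.1 (by linarith)
  refine h (ContinuousLinearMap.ext fun V => ?_)
  rw [fderiv_apply_eq hr, h3, h4]
  simp

theorem toC_one_add (X : ℂ × ℂ → ℝ) : toC (fun q => 1 + X q) = fun q => 1 + toC X q := by
  funext q; simp [toC]

theorem wirtinger_one_add (F : ℂ × ℂ → ℂ) (v : ℂ × ℂ) :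
    wirtinger v (fun q => 1 + F q) = wirtinger v F := by
  funext q; simp [wirtinger, fderiv_const_add]

theorem hessianTangent_one_add (X r : ℂ × ℂ → ℝ) (p : ℂ × ℂ) :
    hessianTangent (fun q => 1 + X q) r p = hessianTangent X r p := by
  simp only [hessianTangent, hessianForm, complexHessian, toC_one_add, dz, dw, wirtinger_one_add]

theorem tangentDeriv_one_add (X r : ℂ × ℂ → ℝ) (p : ℂ × ℂ) :
    tangentDeriv r (fun q => 1 + X q) p = tangentDeriv r X p := by
  simp only [tangentDeriv, toC_one_add, dz, dw, wirtinger_one_add]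

/-! ### The Hessian of ρ in the frame L_r, N_r -/

section Modified

variable {r X : ℂ × ℂ → ℝ} {p : ℂ × ℂ}

/-- Every term containing ∂r applied to L_r drops out because r_z r_w - r_w r_z = 0. -/
theorem hessianTangent_modified (hr : ContDiffAt ℝ 2 r p) (hX : ContDiffAt ℝ 2 X p) (K L : ℝ) :
    hessianTangent (modified r X K L) r p
      = (1 + 2 * K * r p + L * X p) * leviForm r p + L * r p * hessianTangent X r p := by
  have h0 : dz (toC r) p * dw (toC r) p + dw (toC r) p * -dz (toC r) p = 0 := by ring
  have h1 : (1 + 2 * (K : ℂ) * r p + L * X p) = ((1 + 2 * K * r p + L * X p : ℝ) : ℂ) := by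
    push_cast; ring
  have h2 : (L : ℂ) * r p = ((L * r p : ℝ) : ℂ) := by push_cast; ring
  rw [hessianTangent, hessianForm_modified hr hX]
  simp only [tangentVec, h0]
  rw [h1, h2]
  simp [leviForm, hessianTangent, tangentVec]

theorem hessianForm_modified_tangentVec_normalVec (hr : ContDiffAt ℝ 2 r p)
    (hX : ContDiffAt ℝ 2 X p) (hp : r p = 0) (K L : ℝ) :
    hessianForm (modified r X K L) p (tangentVec r p) (normalVec r p)
      = (1 + L * X p) * hessianForm r p (tangentVec r p) (normalVec r p)
        + L * tangentDeriv r X p * gradSq r p := by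
  have h0 : dz (toC r) p * dw (toC r) p + dw (toC r) p * -dz (toC r) p = 0 := by ring
  rw [hessianForm_modified hr hX, deriv_normalVec (hr.differentiableAt (by simp)), hp]
  simp only [tangentVec, h0, tangentDeriv, Complex.conj_ofReal]
  push_cast
  ring

theorem re_hessianForm_modified_normalVec (hr : ContDiffAt ℝ 2 r p)
    (hX : ContDiffAt ℝ 2 X p) (hp : r p = 0) (K L : ℝ) :
    (hessianForm (modified r X K L) p (normalVec r p) (normalVec r p)).re
      = (hessianForm (modified r X 0 L) p (normalVec r p) (normalVec r p)).re
        + 2 * K * gradSq r p ^ 2 := by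
  rw [hessianForm_modified hr hX, hessianForm_modified hr hX,
    deriv_normalVec (hr.differentiableAt (by simp)), hp, Complex.conj_ofReal]
  have : 2 * (K : ℂ) * ((gradSq r p : ℂ) * gradSq r p) = ((2 * K * gradSq r p ^ 2 : ℝ) : ℂ) := by
    push_cast; ring
  rw [this, Complex.add_re, Complex.ofReal_re]
  simp

end Modified

/-! ### Smoothness of the Hessian coefficients -/

section Smoothness

variable {n : WithTop ℕ∞} {p : ℂ × ℂ}

theorem contDiffAt_dz {f : ℂ × ℂ → ℝ} (hf : ContDiffAt ℝ ∞ f p) : ContDiffAt ℝ ∞ (dz (toC f)) p :=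
  contDiffAt_wirtinger (contDiffAt_toC hf) (by simp) _

theorem contDiffAt_dw {f : ℂ × ℂ → ℝ} (hf : ContDiffAt ℝ ∞ f p) : ContDiffAt ℝ ∞ (dw (toC f)) p :=
  contDiffAt_wirtinger (contDiffAt_toC hf) (by simp) _

theorem contDiffAt_tangentVec {r : ℂ × ℂ → ℝ} (hr : ContDiffAt ℝ ∞ r p) :
    ContDiffAt ℝ ∞ (tangentVec r) p :=
  (contDiffAt_dw hr).prodMk (contDiffAt_dz hr).neg

theorem contDiffAt_normalVec {r : ℂ × ℂ → ℝ} (hr : ContDiffAt ℝ ∞ r p) :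
    ContDiffAt ℝ ∞ (normalVec r) p :=
  (contDiffAt_wirtingerBar (contDiffAt_toC hr) (by simp) _).prodMk
    (contDiffAt_wirtingerBar (contDiffAt_toC hr) (by simp) _)

theorem contDiffAt_hessianForm {f : ℂ × ℂ → ℝ} {V W : ℂ × ℂ → ℂ × ℂ} (hf : ContDiffAt ℝ ∞ f p)
    (hV : ContDiffAt ℝ ∞ V p) (hW : ContDiffAt ℝ ∞ W p) :
    ContDiffAt ℝ ∞ (fun q => hessianForm f q (V q) (W q)) p := by
  have hB : ∀ u, ContDiffAt ℝ ∞ (wirtingerBar u (dz (toC f))) p := fun u =>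
    contDiffAt_wirtingerBar (contDiffAt_dz hf) (by simp) u
  have hB' : ∀ u, ContDiffAt ℝ ∞ (wirtingerBar u (dw (toC f))) p := fun u =>
    contDiffAt_wirtingerBar (contDiffAt_dw hf) (by simp) u
  have hc : ∀ {g : ℂ × ℂ → ℂ}, ContDiffAt ℝ ∞ g p → ContDiffAt ℝ ∞ (fun q => conj (g q)) p :=
    fun hg => Complex.conjCLE.contDiff.contDiffAt.comp p hg
  simp only [hessianForm, complexHessian, dzBar, dwBar, Matrix.of_apply, Matrix.cons_val',
    Matrix.cons_val_zero, Matrix.cons_val_one, Matrix.cons_val_fin_one]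
  exact ((((hB _).mul hV.fst).mul (hc hW.fst)).add (((hB' _).mul hV.snd).mul (hc hW.snd))).add
    (((hB _).mul hV.fst).mul (hc hW.snd)) |>.add (((hB' _).mul hV.snd).mul (hc hW.fst))

theorem contDiffAt_re {g : ℂ × ℂ → ℂ} (hg : ContDiffAt ℝ ∞ g p) :
    ContDiffAt ℝ ∞ (fun q => (g q).re) p :=
  Complex.reCLM.contDiff.contDiffAt.comp p hg

theorem contDiffAt_hessianTangent {f r : ℂ × ℂ → ℝ} (hf : ContDiffAt ℝ ∞ f p)
    (hr : ContDiffAt ℝ ∞ r p) : ContDiffAt ℝ ∞ (hessianTangent f r) p :=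
  contDiffAt_re (contDiffAt_hessianForm hf (contDiffAt_tangentVec hr) (contDiffAt_tangentVec hr))

theorem contDiffAt_modified {r X : ℂ × ℂ → ℝ} (hr : ContDiffAt ℝ n r p) (hX : ContDiffAt ℝ n X p)
    (K L : ℝ) : ContDiffAt ℝ n (modified r X K L) p :=
  hr.mul ((contDiffAt_const.add (contDiffAt_const.mul hr)).add (contDiffAt_const.mul hX))

theorem eventually_contDiffAt_two {f : ℂ × ℂ → ℝ} (hf : ContDiffAt ℝ ∞ f p) :
    ∀ᶠ q in 𝓝 p, ContDiffAt ℝ 2 f q :=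
  (hf.of_le (m := 2) ENat.LEInfty.out).eventually (by simp)

end Smoothness

/-- First order expansion along the segments from `p` to `p - s V` with `V` close to `v₀`. -/
theorem eventually_norm_sub_add_le {E F : Type*} [NormedAddCommGroup E] [NormedSpace ℝ E]
    [NormedAddCommGroup F] [NormedSpace ℝ F] {f : E → F} {f' : E →L[ℝ] F} {p₀ : E}
    (hf : HasStrictFDerivAt f f' p₀) (v₀ : E) {ε : ℝ} (hε : 0 < ε) :
    ∀ᶠ x : (E × E) × E in 𝓝 ((p₀, p₀), v₀), ∀ s : ℝ, 0 ≤ s → x.1.2 = x.1.1 - s • x.2 →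
      ‖f x.1.2 - f x.1.1 + s • f' v₀‖ ≤ ε * s := by
  have hv : 0 < ‖v₀‖ + 1 := by positivity
  have hc : 0 < ε / 2 / (‖v₀‖ + 1) := by positivity
  have h1 : ∀ᶠ x : (E × E) × E in 𝓝 ((p₀, p₀), v₀),
      ‖f x.1.2 - f x.1.1 - f' (x.1.2 - x.1.1)‖ ≤ ε / 2 / (‖v₀‖ + 1) * ‖x.1.2 - x.1.1‖ := by
    have ht : Tendsto (fun x : (E × E) × E => (x.1.2, x.1.1)) (𝓝 ((p₀, p₀), v₀))
        (𝓝 (p₀, p₀)) :=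
      Continuous.tendsto' (by fun_prop) _ _ rfl
    exact ht.eventually (hf.isLittleO.def hc)
  have h2 : ∀ᶠ x : (E × E) × E in 𝓝 ((p₀, p₀), v₀), ‖f' (x.2 - v₀)‖ < ε / 2 :=
    (Continuous.tendsto' (f := fun x : (E × E) × E => ‖f' (x.2 - v₀)‖) (by fun_prop) _ 0
      (by simp)).eventually_lt_const (by positivity)
  have h3 : ∀ᶠ x : (E × E) × E in 𝓝 ((p₀, p₀), v₀), ‖x.2‖ < ‖v₀‖ + 1 :=
    (Continuous.tendsto' (f := fun x : (E × E) × E => ‖x.2‖) (by fun_prop) _ ‖v₀‖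
      rfl).eventually_lt_const (by linarith)
  filter_upwards [h1, h2, h3] with x h1 h2 h3 s hs hx
  have hsub : x.1.2 - x.1.1 = -(s • x.2) := by rw [hx]; abel
  have heq : f x.1.2 - f x.1.1 + s • f' v₀
      = (f x.1.2 - f x.1.1 - f' (x.1.2 - x.1.1)) - s • f' (x.2 - v₀) := by
    rw [hsub, map_neg, map_smul, map_sub, smul_sub]; abel
  rw [heq]
  refine (norm_sub_le _ _).trans ?_
  have h4 : ε / 2 / (‖v₀‖ + 1) * ‖x.1.2 - x.1.1‖ ≤ ε / 2 * s := by
    rw [hsub, norm_neg, norm_smul, Real.norm_of_nonneg hs, div_mul_eq_mul_div,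
      div_le_iff₀ hv, mul_assoc]
    gcongr
  have h5 : ‖s • f' (x.2 - v₀)‖ ≤ ε / 2 * s := by
    rw [norm_smul, Real.norm_of_nonneg hs, mul_comm]
    gcongr
  linarith

/-! ### The core estimate near p₀ -/

section Main

variable {r X : ℂ × ℂ → ℝ} {p₀ : ℂ × ℂ}

/-- At p₀ the functions r, X and the Levi form all vanish, so the product rule kills the derivative
of the factor containing K. -/
theorem fderiv_hessianTangent_modified (hr : ContDiffAt ℝ ∞ r p₀) (hX : ContDiffAt ℝ ∞ X p₀)
    (hr₀ : r p₀ = 0) (hX₀ : X p₀ = 0) (hlevi : leviForm r p₀ = 0) (K L : ℝ) (v : ℂ × ℂ) :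
    fderiv ℝ (hessianTangent (modified r X K L) r) p₀ v
      = fderiv ℝ (leviForm r) p₀ v + L * (hessianTangent X r p₀ * fderiv ℝ r p₀ v) := by
  have h : hessianTangent (modified r X K L) r =ᶠ[𝓝 p₀] fun q =>
      (1 + 2 * K * r q + L * X q) * leviForm r q + L * r q * hessianTangent X r q := by
    filter_upwards [eventually_contDiffAt_two hr, eventually_contDiffAt_two hX] with q h1 h2
    exact hessianTangent_modified h1 h2 K L
  have dr := (hr.differentiableAt (by simp)).hasFDerivAt
  have dX := (hX.differentiableAt (by simp)).hasFDerivAt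
  have dl : HasFDerivAt (leviForm r) (fderiv ℝ (leviForm r) p₀) p₀ :=
    ((contDiffAt_hessianTangent hr hr).differentiableAt (by simp)).hasFDerivAt
  have dh := ((contDiffAt_hessianTangent hX hr).differentiableAt (by simp)).hasFDerivAt
  have d := (((((dr.const_mul (2 * K)).const_add 1).fun_add (dX.const_mul L)).fun_mul dl).fun_add
    ((dr.const_mul L).fun_mul dh))
  rw [h.fderiv_eq, d.fderiv]
  simp [hr₀, hX₀, hlevi]
  ring

/-- Stated for an arbitrary set E of boundary points and for directions near N_r(p₀), so that it
covers both the varying normals from W and a fixed direction from all of bΩ. The threshold K₀ comes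
first; the neighborhood may shrink with K. -/
theorem exists_eventually_pshAt (hr : ContDiffAt ℝ ∞ r p₀) (hX : ContDiffAt ℝ ∞ X p₀)
    (hr₀ : r p₀ = 0) (hX₀ : X p₀ = 0) (hlevi : leviForm r p₀ = 0) (hdr : fderiv ℝ r p₀ ≠ 0)
    {E : Set (ℂ × ℂ)} {C L : ℝ}
    (hE : ∀ᶠ p in 𝓝 p₀, p ∈ E → r p = 0 ∧ 0 ≤ leviForm r p ∧
      Complex.normSq (hessianForm (modified r X 0 L) p (tangentVec r p) (normalVec r p))
        ≤ C * leviForm r p)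
    (hA : fderiv ℝ (leviForm r) p₀ (normalVec r p₀)
      + L * (hessianTangent X r p₀ * fderiv ℝ r p₀ (normalVec r p₀)) < 0) :
    ∃ K₀ : ℝ, 0 < K₀ ∧ ∀ K ≥ K₀, ∀ᶠ x : ((ℂ × ℂ) × (ℂ × ℂ)) × (ℂ × ℂ) in
      𝓝 ((p₀, p₀), normalVec r p₀), x.1.1 ∈ E → ∀ s : ℝ, 0 ≤ s → x.1.2 = x.1.1 - s • x.2 →
        PshAt (modified r X K L) x.1.2 := by
  have hn := gradSq_pos (hr.differentiableAt (by simp)) hdr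
  set n := gradSq r p₀ with hn_def
  set c₀ := (hessianForm (modified r X 0 L) p₀ (normalVec r p₀) (normalVec r p₀)).re with hc₀
  -- At p₀ one has c = c₀ + 2Kn²; this threshold makes it exceed 4|C|+1, and the final +1 makes the
  -- inequality strict.
  refine ⟨(4 * |C| + 1 + |c₀|) / (2 * n ^ 2) + 1, by positivity, fun K hK => ?_⟩
  have hm := contDiffAt_modified hr hX K L
  have hT := contDiffAt_tangentVec hr
  have hN := contDiffAt_normalVec hr
  set a := hessianTangent (modified r X K L) r with ha_def
  set b := fun q => hessianForm (modified r X K L) q (tangentVec r q) (normalVec r q) with hb_def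
  set c := fun q => (hessianForm (modified r X K L) q (normalVec r q) (normalVec r q)).re
    with hc_def
  have ha : ContDiffAt ℝ ∞ a p₀ := contDiffAt_hessianTangent hm hr
  have hb : ContDiffAt ℝ ∞ b p₀ := contDiffAt_hessianForm hm hT hN
  have hc : ContDiffAt ℝ ∞ c p₀ := contDiffAt_re (contDiffAt_hessianForm hm hN hN)
  have hr2 := eventually_contDiffAt_two hr
  have hX2 := eventually_contDiffAt_two hX
  set A := -fderiv ℝ a p₀ (normalVec r p₀) with hA_def
  have hA0 : 0 < A := by
    rw [hA_def, ha_def, fderiv_hessianTangent_modified hr hX hr₀ hX₀ hlevi]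
    linarith
  have hcp : 4 * |C| + 1 < c p₀ := by
    have h1 : c p₀ = c₀ + 2 * K * n ^ 2 :=
      re_hessianForm_modified_normalVec hr2.self_of_nhds hX2.self_of_nhds hr₀ K L
    have h2 : (4 * |C| + 1 + |c₀|) / (2 * n ^ 2) < K := by linarith
    rw [div_lt_iff₀ (by positivity)] at h2
    have := neg_abs_le c₀
    rw [h1]; linarith
  set M := ‖fderiv ℝ b p₀ (normalVec r p₀)‖ + 1 with hM
  have hM0 : 0 < M := by positivity
  have est_a := eventually_norm_sub_add_le (ha.hasStrictFDerivAt (by simp)) (normalVec r p₀)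
    (half_pos hA0)
  have est_b := eventually_norm_sub_add_le (hb.hasStrictFDerivAt (by simp)) (normalVec r p₀)
    one_pos
  have tp : Tendsto (fun x : ((ℂ × ℂ) × (ℂ × ℂ)) × (ℂ × ℂ) => x.1.1)
      (𝓝 ((p₀, p₀), normalVec r p₀)) (𝓝 p₀) := Continuous.tendsto' (by fun_prop) _ _ rfl
  have tq : Tendsto (fun x : ((ℂ × ℂ) × (ℂ × ℂ)) × (ℂ × ℂ) => x.1.2)
      (𝓝 ((p₀, p₀), normalVec r p₀)) (𝓝 p₀) := Continuous.tendsto' (by fun_prop) _ _ rfl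
  -- Combined with |Δb| ≤ Ms below, smallness A/(4M) gives |Δb|² ≤ (A/4)s, linear in s and
  -- comparable to the gain in a.
  have hbc : ∀ᶠ x : ((ℂ × ℂ) × (ℂ × ℂ)) × (ℂ × ℂ) in 𝓝 ((p₀, p₀), normalVec r p₀),
      ‖b x.1.2 - b x.1.1‖ < A / (4 * M) := by
    have h := ((hb.continuousAt.tendsto.comp tq).sub (hb.continuousAt.tendsto.comp tp)).norm
    rw [sub_self, norm_zero] at h
    exact h.eventually_lt_const (by positivity)
  have hXp : ∀ᶠ p in 𝓝 p₀, 1 / 2 < 1 + L * X p := by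
    have h : Tendsto (fun p => 1 + L * X p) (𝓝 p₀) (𝓝 (1 + L * X p₀)) :=
      ((hX.continuousAt.const_mul L).const_add 1)
    exact h.eventually_const_lt (by rw [hX₀]; norm_num)
  have hgrad : ∀ᶠ q in 𝓝 p₀, fderiv ℝ r q ≠ 0 :=
    (hr.fderiv_right (m := 0) (by simp)).continuousAt.eventually_ne hdr
  have hcq := hc.continuousAt.tendsto.eventually_const_lt hcp
  filter_upwards [est_a, est_b, hbc, tp.eventually hE, tp.eventually hXp, tp.eventually hr2,
    tp.eventually hX2, tq.eventually hr2, tq.eventually hX2, tq.eventually hgrad,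
    tq.eventually hcq] with x ea eb ebc hEx hXx rp Xp rq Xq gq cq hxE s hs hx
  obtain ⟨hp0, hl, hbl⟩ := hEx hxE
  have ea := ea s hs hx
  have eb := eb s hs hx
  have rd := rq.differentiableAt (by simp)
  have hap : a x.1.1 = (1 + L * X x.1.1) * leviForm r x.1.1 := by
    rw [ha_def, hessianTangent_modified rp Xp, hp0]; ring
  have haq : leviForm r x.1.1 / 2 + A / 2 * s ≤ a x.1.2 := by
    rw [Real.norm_eq_abs, smul_eq_mul] at ea
    have h1 := (abs_le.1 ea).1
    have h2 : leviForm r x.1.1 / 2 ≤ a x.1.1 := by rw [hap]; nlinarith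
    nlinarith
  have hbp : Complex.normSq (b x.1.1) ≤ |C| * leviForm r x.1.1 := by
    have : b x.1.1 = hessianForm (modified r X 0 L) x.1.1 (tangentVec r x.1.1)
        (normalVec r x.1.1) := by
      rw [hb_def]
      simp only [hessianForm_modified_tangentVec_normalVec rp Xp hp0]
    rw [this]
    exact hbl.trans (mul_le_mul_of_nonneg_right (le_abs_self C) hl)
  have hbd : ‖b x.1.2 - b x.1.1‖ ≤ M * s := by
    have h1 : b x.1.2 - b x.1.1 = (b x.1.2 - b x.1.1 + s • fderiv ℝ b p₀ (normalVec r p₀))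
        - s • fderiv ℝ b p₀ (normalVec r p₀) := by abel
    rw [h1]
    refine (norm_sub_le _ _).trans ?_
    rw [norm_smul, Real.norm_of_nonneg hs, hM]
    linarith
  -- Uses (x+y)² ≤ 2x² + 2y².
  have hbq : Complex.normSq (b x.1.2) ≤ 2 * (|C| * leviForm r x.1.1) + A / 2 * s := by
    rw [Complex.normSq_eq_norm_sq] at hbp ⊢
    have h1 : ‖b x.1.2‖ ≤ ‖b x.1.1‖ + ‖b x.1.2 - b x.1.1‖ := norm_le_norm_add_norm_sub' _ _
    have h2 : ‖b x.1.2 - b x.1.1‖ ^ 2 ≤ A / 4 * s := by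
      calc ‖b x.1.2 - b x.1.1‖ ^ 2 = ‖b x.1.2 - b x.1.1‖ * ‖b x.1.2 - b x.1.1‖ := sq _
        _ ≤ A / (4 * M) * (M * s) := by gcongr
        _ = A / 4 * s := by field_simp
    nlinarith [norm_nonneg (b x.1.2), sq_nonneg (‖b x.1.1‖ - ‖b x.1.2 - b x.1.1‖)]
  refine pshAt_of_pos_of_le (V := tangentVec r x.1.2) (W := normalVec r x.1.2)
    (contDiffAt_modified rq Xq K L) ?_ ?_ ?_
  · rw [wedge_tangentVec_normalVec rd]
    exact_mod_cast (gradSq_pos rd gq).ne'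
  · have := abs_nonneg C
    linarith
  · change Complex.normSq (b x.1.2) ≤ a x.1.2 * c x.1.2
    have hC := abs_nonneg C
    have h1 : 0 ≤ leviForm r x.1.1 / 2 + A / 2 * s := by positivity
    calc Complex.normSq (b x.1.2) ≤ 2 * (|C| * leviForm r x.1.1) + A / 2 * s := hbq
      -- The 4|C| absorbs the Levi term and the 1 absorbs the term in s.
      _ ≤ (leviForm r x.1.1 / 2 + A / 2 * s) * (4 * |C| + 1) := by
        nlinarith [mul_nonneg hC (mul_nonneg hA0.le hs)]
      _ ≤ (leviForm r x.1.1 / 2 + A / 2 * s) * c x.1.2 := by gcongr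
      _ ≤ a x.1.2 * c x.1.2 := by gcongr; linarith

end Main

/-! ### Boundary geometry, the slope criterion and the two applications -/

section Boundary

variable {r X : ℂ × ℂ → ℝ} {Ω : Set (ℂ × ℂ)} {p₀ : ℂ × ℂ}

theorem IsDefiningFunction.isOpen (hr : IsDefiningFunction r Ω) : IsOpen Ω := by
  rw [hr.eq_sublevel]
  exact isOpen_lt hr.smooth.continuous continuous_const

theorem IsDefiningFunction.nonpos_of_mem_closure (hr : IsDefiningFunction r Ω) {p : ℂ × ℂ}
    (hp : p ∈ closure Ω) : r p ≤ 0 := by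
  have h : Ω ⊆ {p | r p ≤ 0} := by
    rw [hr.eq_sublevel]
    exact fun q (hq : r q < 0) => hq.le
  exact closure_minimal h (isClosed_le hr.smooth.continuous continuous_const) hp

theorem IsDefiningFunction.eq_zero_of_mem_frontier (hr : IsDefiningFunction r Ω) {p : ℂ × ℂ}
    (hp : p ∈ frontier Ω) : r p = 0 := by
  rw [hr.isOpen.frontier_eq] at hp
  refine le_antisymm (hr.nonpos_of_mem_closure hp.1) (not_lt.1 fun h => hp.2 ?_)
  rw [hr.eq_sublevel]
  exact h

/-- Points of `Ω̄` near `p₀` are reached from nearby boundary points by moving in a fixed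
direction `-v` that points inward at `p₀`. -/
theorem IsDefiningFunction.eventually_exists_frontier (hr : IsDefiningFunction r Ω)
    (hp₀ : r p₀ = 0) {v : ℂ × ℂ} (hv : 0 < fderiv ℝ r p₀ v) {U : Set (ℂ × ℂ)} (hU : U ∈ 𝓝 p₀) :
    ∀ᶠ q in 𝓝 p₀, q ∈ closure Ω → ∃ p ∈ U ∩ frontier Ω, ∃ s : ℝ, 0 ≤ s ∧ q = p - s • v := by
  have hcont := hr.smooth.continuous
  have h := eventually_norm_sub_add_le (hr.smooth.contDiffAt.hasStrictFDerivAt (by simp)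
    : HasStrictFDerivAt r (fderiv ℝ r p₀) p₀) v (half_pos hv)
  have hpair : Tendsto (fun y : (ℂ × ℂ) × (ℂ × ℂ) => (y, v)) (𝓝 (p₀, p₀)) (𝓝 ((p₀, p₀), v)) :=
    Continuous.tendsto' (by fun_prop) _ _ rfl
  have h := hpair.eventually h
  rw [nhds_prod_eq] at h
  obtain ⟨S, hS, hS'⟩ := eventually_prod_self_iff'.1 h
  obtain ⟨δ, hδ, hball⟩ := Metric.mem_nhds_iff.1 (inter_mem hS hU)
  -- Near p₀, r decreases at a definite rate in the direction -v.
  have hmono : ∀ p ∈ Metric.ball p₀ δ, ∀ s : ℝ, 0 ≤ s → p - s • v ∈ Metric.ball p₀ δ →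
      r (p - s • v) + fderiv ℝ r p₀ v / 2 * s ≤ r p := by
    intro p hp s hs hq
    have h1 := hS' p (hball hp).1 _ (hball hq).1 s hs rfl
    rw [Real.norm_eq_abs, smul_eq_mul] at h1
    have := (abs_le.1 h1).2
    simp only at this
    linarith
  have hline : ∀ u : ℂ × ℂ, Tendsto (fun t : ℝ => u + t • v) (𝓝[>] 0) (𝓝 u) := fun u =>
    (Continuous.tendsto' (by fun_prop) _ _ (by simp)).mono_left nhdsWithin_le_nhds
  obtain ⟨τ, hτv, hτ⟩ : ∃ τ : ℝ, τ * ‖v‖ < δ / 2 ∧ 0 < τ := by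
    have h1 : Tendsto (fun t : ℝ => t * ‖v‖) (𝓝[>] 0) (𝓝 0) :=
      (Continuous.tendsto' (by fun_prop) _ _ (by simp)).mono_left nhdsWithin_le_nhds
    exact ((h1.eventually_lt_const (half_pos hδ)).and self_mem_nhdsWithin).exists
  have hin : ∀ q ∈ Metric.ball p₀ (δ / 2), ∀ t ∈ Set.Icc 0 τ, q + t • v ∈ Metric.ball p₀ δ := by
    intro q hq t ht
    rw [mem_ball_iff_norm] at hq ⊢
    calc ‖q + t • v - p₀‖ = ‖(q - p₀) + t • v‖ := by congr 1; abel
      _ ≤ ‖q - p₀‖ + ‖t • v‖ := norm_add_le _ _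
      _ ≤ ‖q - p₀‖ + τ * ‖v‖ := by
        rw [norm_smul, Real.norm_of_nonneg ht.1]
        have := ht.2
        gcongr
      _ < δ := by linarith
  have hpos : 0 < r (p₀ + τ • v) := by
    have hb := hin p₀ (Metric.mem_ball_self (half_pos hδ)) τ ⟨hτ.le, le_rfl⟩
    have h1 := hmono _ hb τ hτ.le (by simpa using hδ)
    rw [add_sub_cancel_right, hp₀] at h1
    have : 0 < fderiv ℝ r p₀ v / 2 * τ := by positivity
    linarith
  have hpos' : ∀ᶠ q in 𝓝 p₀, 0 < r (q + τ • v) :=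
    (Continuous.tendsto (f := fun q => r (q + τ • v)) (by fun_prop) p₀).eventually_const_lt hpos
  filter_upwards [hpos', Metric.ball_mem_nhds p₀ (half_pos hδ)] with q hq hqb hqΩ
  -- The line from q in direction v goes from r ≤ 0 to r > 0, so it meets {r = 0}.
  obtain ⟨t, ht, hrt⟩ := intermediate_value_Icc (f := fun t : ℝ => r (q + t • v)) hτ.le
    (by fun_prop) (show (0 : ℝ) ∈ _ from ⟨by simpa using hr.nonpos_of_mem_closure hqΩ, hq.le⟩)
  have hb := hin q hqb t ht
  refine ⟨q + t • v, ⟨(hball hb).2, ?_⟩, t, ht.1, by simp⟩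
  rw [hr.isOpen.frontier_eq]
  refine ⟨?_, fun hmem => ?_⟩
  -- The zero of r is a limit of the points slightly further along -v, where r < 0.
  · have hlim : Tendsto (fun σ : ℝ => q + t • v - σ • v) (𝓝[>] 0) (𝓝 (q + t • v)) :=
      (Continuous.tendsto' (by fun_prop) _ _ (by simp)).mono_left nhdsWithin_le_nhds
    refine mem_closure_of_tendsto hlim ?_
    filter_upwards [hlim.eventually (Metric.isOpen_ball.mem_nhds hb), self_mem_nhdsWithin]
      with σ h1 h2
    have h2 : 0 < σ := h2
    have h3 := hmono _ hb σ h2.le h1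
    have : 0 < fderiv ℝ r p₀ v / 2 * σ := by positivity
    rw [hr.eq_sublevel]
    simp only at hrt
    simp only [Set.mem_ofPred_eq]
    linarith
  · rw [hr.eq_sublevel] at hmem
    exact absurd hmem (by simp only at hrt; simp [hrt])

/-- The derivative at `p₀`, along the outward normal, of `H_ρ(L_r, L_r)`, where
`ρ = r (1 + K r + L X)`; it does not depend on `K`. -/
noncomputable def normalSlope (r X : ℂ × ℂ → ℝ) (p₀ : ℂ × ℂ) (L : ℝ) : ℝ :=
  fderiv ℝ (leviForm r) p₀ (normalVec r p₀)
    + L * (hessianTangent X r p₀ * fderiv ℝ r p₀ (normalVec r p₀))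

/-- H_ρ(L_r,L_r) vanishes at p₀, so a positive outward slope would make it negative just inside
along the normal. -/
theorem normalSlope_nonpos (hr : IsDefiningFunction r Ω) (hp₀ : p₀ ∈ weakPoints r Ω)
    (hX : ContDiffAt ℝ ∞ X p₀) (hX₀ : X p₀ = 0) {K L : ℝ}
    (h : PshOnWeakNormalsNear (modified r X K L) r Ω p₀) : normalSlope r X p₀ L ≤ 0 := by
  by_contra! hpos
  obtain ⟨U, hU, hpsh⟩ := h
  have hrp := hr.smooth.contDiffAt (x := p₀)
  have hr₀ := hr.eq_zero_of_mem_frontier hp₀.1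
  have ha := contDiffAt_hessianTangent (contDiffAt_modified hrp hX K L) hrp
  have hslope := fderiv_hessianTangent_modified hrp hX hr₀ hX₀ hp₀.2 K L (normalVec r p₀)
  rw [← normalSlope] at hslope
  have est := eventually_norm_sub_add_le (ha.hasStrictFDerivAt (by simp)) (normalVec r p₀)
    (half_pos hpos)
  have hq : Tendsto (fun s : ℝ => p₀ - s • normalVec r p₀) (𝓝[>] 0) (𝓝 p₀) :=
    (Continuous.tendsto' (by fun_prop) _ _ (by simp)).mono_left nhdsWithin_le_nhds
  have hx : Tendsto (fun s : ℝ => ((p₀, p₀ - s • normalVec r p₀), normalVec r p₀)) (𝓝[>] 0)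
      (𝓝 ((p₀, p₀), normalVec r p₀)) :=
    (tendsto_const_nhds.prodMk_nhds hq).prodMk_nhds tendsto_const_nhds
  obtain ⟨s, est, hsU, hX2, hs⟩ := ((hx.eventually est).and ((hq.eventually hU).and
    ((hq.eventually (eventually_contDiffAt_two hX)).and self_mem_nhdsWithin))).exists
  have hs : 0 < s := hs
  have est := est s hs.le rfl
  simp only [hslope] at est
  have hm : ContDiffAt ℝ 2 (modified r X K L) (p₀ - s • normalVec r p₀) :=
    contDiffAt_modified (hr.smooth.contDiffAt.of_le ENat.LEInfty.out) hX2 K L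
  have h1 : 0 ≤ hessianTangent (modified r X K L) r (p₀ - s • normalVec r p₀) :=
    (pshAt_iff hm).1 (hpsh p₀ ⟨mem_of_mem_nhds hU, hp₀⟩ s hs.le hsU) _
  have h2 : hessianTangent (modified r X K L) r p₀ = 0 := by
    rw [hessianTangent_modified (hrp.of_le ENat.LEInfty.out) (hX.of_le ENat.LEInfty.out), hp₀.2, hr₀]
    ring
  rw [h2, Real.norm_eq_abs, smul_eq_mul] at est
  have := (abs_le.1 est).2
  nlinarith [mul_pos hs hpos]

/-- A nonconstant affine function that is ≤ 0 on S cannot vanish at an interior point: stepping by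
tβ increases it. -/
theorem lt_zero_of_mem_interior {S : Set ℝ} {α β L : ℝ} (hS : ∀ x ∈ S, α + x * β ≤ 0)
    (hβ : β ≠ 0) (hL : L ∈ interior S) : α + L * β < 0 := by
  have h : Tendsto (fun t : ℝ => L + t * β) (𝓝[>] 0) (𝓝 L) :=
    (Continuous.tendsto' (by fun_prop) _ _ (by simp)).mono_left nhdsWithin_le_nhds
  obtain ⟨t, ht, ht0⟩ := ((h.eventually (mem_interior_iff_mem_nhds.1 hL)).and
    self_mem_nhdsWithin).exists
  have h1 := hS _ ht
  have h2 : 0 < t * (β * β) := mul_pos ht0 (mul_self_pos.2 hβ)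
  linarith

theorem fderiv_normalVec_pos (hr : IsDefiningFunction r Ω) (hp₀ : p₀ ∈ frontier Ω) :
    0 < fderiv ℝ r p₀ (normalVec r p₀) := by
  have hd : DifferentiableAt ℝ r p₀ := hr.smooth.differentiable (by simp) p₀
  rw [fderiv_normalVec hd]
  have := gradSq_pos hd (hr.fderiv_ne_zero p₀ hp₀)
  positivity

theorem normalSlope_neg_of_mem_admissibleInterval (hr : IsDefiningFunction r Ω)
    (hp₀ : p₀ ∈ weakPoints r Ω) (hX : ContDiffAt ℝ ∞ X p₀) (hX₀ : X p₀ = 0)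
    (hH : hessianTangent X r p₀ ≠ 0) {L : ℝ} (hL : L ∈ admissibleInterval r X Ω p₀) :
    normalSlope r X p₀ L < 0 :=
  lt_zero_of_mem_interior
    (fun _ hx => hx.elim fun K₀ hK => normalSlope_nonpos hr hp₀ hX hX₀ (hK K₀ le_rfl))
    (mul_ne_zero hH (fderiv_normalVec_pos hr hp₀.1).ne') hL

theorem admissibleInterval_eq (hr : IsDefiningFunction r Ω)
    (hp₀ : p₀ ∈ weakPoints r Ω) (hX : ContDiffAt ℝ ∞ X p₀) (hX₀ : X p₀ = 0)
    (h1 : ∀ᶠ p in 𝓝 p₀, p ∈ weakPoints r Ω → tangentDeriv r X p = 0)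
    (hH : hessianTangent X r p₀ ≠ 0) (hpsh : PshOnBoundaryNear r Ω p₀) :
    admissibleInterval r X Ω p₀ = {L | normalSlope r X p₀ L < 0} := by
  refine Set.Subset.antisymm
    (fun L => normalSlope_neg_of_mem_admissibleInterval hr hp₀ hX hX₀ hH) ?_
  refine interior_maximal (fun L hL => ?_)
    (isOpen_lt (by unfold normalSlope; fun_prop) continuous_const)
  have hrp := hr.smooth.contDiffAt (x := p₀)
  -- On W the mixed term vanishes identically, so the core estimate applies with C = 0.
  have hE : ∀ᶠ p in 𝓝 p₀, p ∈ weakPoints r Ω → r p = 0 ∧ 0 ≤ leviForm r p ∧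
      Complex.normSq (hessianForm (modified r X 0 L) p (tangentVec r p) (normalVec r p))
        ≤ 0 * leviForm r p := by
    filter_upwards [h1, hpsh, eventually_contDiffAt_two hX] with p h1 h2 h3 hp
    have hrp2 : ContDiffAt ℝ 2 r p := hr.smooth.contDiffAt.of_le ENat.LEInfty.out
    have hp0 := hr.eq_zero_of_mem_frontier hp.1
    refine ⟨hp0, hp.2.ge, ?_⟩
    rw [hessianForm_modified_tangentVec_normalVec hrp2 h3 hp0, h1 hp,
      hessianForm_eq_zero_of_pshAt hrp2 (h2 hp.1) hp.2]
    simp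
  obtain ⟨K₀, -, hK⟩ := exists_eventually_pshAt hrp hX (hr.eq_zero_of_mem_frontier hp₀.1) hX₀
    hp₀.2 (hr.fderiv_ne_zero p₀ hp₀.1) hE hL
  refine ⟨K₀, fun K hKK => ?_⟩
  -- The direction is the normal at the base point itself, which tends to N_r(p₀) by continuity.
  have ht : Tendsto (fun y : (ℂ × ℂ) × (ℂ × ℂ) => (y, normalVec r y.1)) (𝓝 (p₀, p₀))
      (𝓝 ((p₀, p₀), normalVec r p₀)) :=
    tendsto_id.prodMk_nhds ((contDiffAt_normalVec hrp).continuousAt.tendsto.comp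
      (continuous_fst.tendsto (p₀, p₀)))
  have h := ht.eventually (hK K hKK)
  rw [nhds_prod_eq] at h
  obtain ⟨U, hU, hUU⟩ := eventually_prod_self_iff'.1 h
  exact ⟨U, hU, fun p hp s hs hq => hUU p hp.1 _ hq hp.2 s hs rfl⟩

/-- By the Gram identity |b|² = ac - det·|L_r ∧ N_r|². On E, a is (1+LX) times the Levi form and
-det is at most C times it, so the Levi form factors out with a locally bounded coefficient. -/
theorem exists_normSq_hessianForm_le (hr : ContDiffAt ℝ ∞ r p₀) (hX : ContDiffAt ℝ ∞ X p₀)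
    {E : Set (ℂ × ℂ)} {C L : ℝ} (hE : ∀ᶠ p in 𝓝 p₀, p ∈ E → r p = 0 ∧ 0 ≤ leviForm r p)
    (h : ∀ᶠ p in 𝓝 p₀, p ∈ E → -hessianDet (modified r X 0 L) p ≤ C * leviForm r p) :
    ∃ C' : ℝ, ∀ᶠ p in 𝓝 p₀, p ∈ E → r p = 0 ∧ 0 ≤ leviForm r p ∧
      Complex.normSq (hessianForm (modified r X 0 L) p (tangentVec r p) (normalVec r p))
        ≤ C' * leviForm r p := by
  have hN := contDiffAt_normalVec hr
  have hc := (contDiffAt_re (contDiffAt_hessianForm (contDiffAt_modified hr hX 0 L) hN hN))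
  have hB : ContDiffAt ℝ ∞ (fun p => (1 + L * X p)
      * (hessianForm (modified r X 0 L) p (normalVec r p) (normalVec r p)).re
      + C * Complex.normSq ((tangentVec r p).1 * (normalVec r p).2
        - (tangentVec r p).2 * (normalVec r p).1)) p₀ := by
    have hT := contDiffAt_tangentVec hr
    have hw := (hT.fst.mul hN.snd).sub (hT.snd.mul hN.fst)
    have hsq : ContDiffAt ℝ ∞ (fun p => Complex.normSq ((tangentVec r p).1 * (normalVec r p).2
        - (tangentVec r p).2 * (normalVec r p).1)) p₀ := by
      simp only [Complex.normSq_eq_norm_sq]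
      exact hw.norm_sq ℝ
    exact ((contDiffAt_const.add (contDiffAt_const.mul hX)).mul hc).add (contDiffAt_const.mul hsq)
  -- B is any number above the value of that coefficient at p₀.
  obtain ⟨B, hlt⟩ := (exists_gt _).imp fun B => hB.continuousAt.eventually_lt_const (u := B)
  refine ⟨B, ?_⟩
  filter_upwards [hE, h, hlt, eventually_contDiffAt_two hr, eventually_contDiffAt_two hX]
    with p hE h hlt hr2 hX2 hp
  obtain ⟨hp0, hl⟩ := hE hp
  refine ⟨hp0, hl, le_trans ?_ (mul_le_mul_of_nonneg_right hlt.le hl)⟩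
  have hdet := hessianDet_mul_normSq (contDiffAt_modified hr2 hX2 0 L) (tangentVec r p)
    (normalVec r p)
  have hT := hessianTangent_modified hr2 hX2 0 L
  rw [hessianTangent] at hT
  rw [hT, hp0] at hdet
  have := mul_le_mul_of_nonneg_right (h hp) (Complex.normSq_nonneg
    ((tangentVec r p).1 * (normalVec r p).2 - (tangentVec r p).2 * (normalVec r p).1))
  linarith

end Boundary

end PshDefining

/-! ### Assembly of (a) and (b) -/

theorem mainTheorem1 (Ω : Set (ℂ × ℂ)) (r X : ℂ × ℂ → ℝ) (p₀ : ℂ × ℂ)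
    (hr : PshDefining.IsDefiningFunction r Ω)
    (hΩ : PshDefining.PseudoconvexNear r Ω p₀)
    (hp₀ : p₀ ∈ PshDefining.weakPoints r Ω)
    (hX : ContDiffAt ℝ ∞ X p₀) (hX₀ : X p₀ = 0)
    (h1 : ∀ᶠ p in 𝓝 p₀, p ∈ PshDefining.weakPoints r Ω →
      PshDefining.tangentDeriv r (fun q => 1 + X q) p = 0)
    (h2 : PshDefining.hessianTangent (fun q => 1 + X q) r p₀ ≠ 0) :
    (PshDefining.PshOnBoundaryNear r Ω p₀ →
      (0 < PshDefining.hessianTangent (fun q => 1 + X q) r p₀ →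
        ∃ L₀ : ℝ, PshDefining.admissibleInterval r X Ω p₀ = Set.Iio L₀) ∧
      (PshDefining.hessianTangent (fun q => 1 + X q) r p₀ < 0 →
        ∃ L₀ : ℝ, PshDefining.admissibleInterval r X Ω p₀ = Set.Ioi L₀)) ∧
    ∀ L ∈ PshDefining.admissibleInterval r X Ω p₀,
      (∃ C : ℝ, ∀ᶠ p in 𝓝 p₀, p ∈ frontier Ω →
        -PshDefining.hessianDet (fun q => r q * (1 + L * X q)) p
          ≤ C * PshDefining.leviForm r p) →
      ∃ K : ℝ, 0 < K ∧ ∃ U ∈ 𝓝 p₀, ∀ q ∈ U ∩ closure Ω,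
        PshDefining.PshAt (PshDefining.modified r X K L) q := by
  simp only [PshDefining.tangentDeriv_one_add, PshDefining.hessianTangent_one_add] at h1 h2 ⊢
  have hg := PshDefining.fderiv_normalVec_pos hr hp₀.1
  have hrp := hr.smooth.contDiffAt (x := p₀)
  have hr₀ := hr.eq_zero_of_mem_frontier hp₀.1
  refine ⟨fun hpsh => ?_, fun L hL ⟨C, hC⟩ => ?_⟩
  · rw [PshDefining.admissibleInterval_eq hr hp₀ hX hX₀ h1 h2 hpsh]
    set g := fderiv ℝ r p₀ (PshDefining.normalVec r p₀) with hg_def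
    -- In both cases L₀ is the zero of the affine slope; the sign of its leading coefficient decides
    -- the side.
    refine ⟨fun hpos => ⟨-fderiv ℝ (PshDefining.leviForm r) p₀ (PshDefining.normalVec r p₀)
      / (PshDefining.hessianTangent X r p₀ * g), ?_⟩,
      fun hneg => ⟨-fderiv ℝ (PshDefining.leviForm r) p₀ (PshDefining.normalVec r p₀)
      / (PshDefining.hessianTangent X r p₀ * g), ?_⟩⟩
    · ext L
      rw [Set.mem_Iio, lt_div_iff₀ (mul_pos hpos hg), Set.mem_ofPred_eq, PshDefining.normalSlope]
      constructor <;> intro h <;> linarith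
    · ext L
      rw [Set.mem_Ioi, div_lt_iff_of_neg (mul_neg_of_neg_of_pos hneg hg), Set.mem_ofPred_eq,
        PshDefining.normalSlope]
      constructor <;> intro h <;> linarith
  · have hmod : (fun q => r q * (1 + L * X q)) = PshDefining.modified r X 0 L := by
      funext q; simp [PshDefining.modified]
    rw [hmod] at hC
    have hE : ∀ᶠ p in 𝓝 p₀, p ∈ frontier Ω → r p = 0 ∧ 0 ≤ PshDefining.leviForm r p :=
      hΩ.mono fun p h hp => ⟨hr.eq_zero_of_mem_frontier hp, h hp⟩
    obtain ⟨C', hE'⟩ := PshDefining.exists_normSq_hessianForm_le hrp hX hE hC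
    obtain ⟨K, hK, hpsh⟩ := PshDefining.exists_eventually_pshAt hrp hX hr₀ hX₀ hp₀.2
      (hr.fderiv_ne_zero p₀ hp₀.1) hE'
      (PshDefining.normalSlope_neg_of_mem_admissibleInterval hr hp₀ hX hX₀ h2 hL)
    -- Here the direction is frozen at N_r(p₀), matching the lines that reach every nearby point of
    -- Ω̄.
    have ht : Tendsto (fun y : (ℂ × ℂ) × (ℂ × ℂ) => (y, PshDefining.normalVec r p₀))
        (𝓝 (p₀, p₀)) (𝓝 ((p₀, p₀), PshDefining.normalVec r p₀)) :=
      Continuous.tendsto' (by fun_prop) _ _ rfl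
    have h := ht.eventually (hpsh K le_rfl)
    rw [nhds_prod_eq] at h
    obtain ⟨U, hU, hUU⟩ := eventually_prod_self_iff'.1 h
    refine ⟨K, hK, _, inter_mem hU (hr.eventually_exists_frontier hr₀ hg hU), ?_⟩
    rintro q ⟨⟨hqU, hq⟩, hqΩ⟩
    obtain ⟨p, hp, s, hs, rfl⟩ := hq hqΩ
    exact hUU p hp.1 _ hqU hp.2 s hs rfl
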